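/- Let $s,n\ge 0$ be integers, let $A$ be an $s\times n$ integer matrix of rank $m$, and let $p\in\mathbb Z^n$. Let $U\in \mathrm{GL}_s(\mathbb Z)$ and $V\in \mathrm{GL}_n(\mathbb Z)$ be such that $UAV=D$ is in Smith normal form, i.e. $D$ is zero off the diagonal and its diagonal entries are nonnegative integers $d_1\mid d_2\mid\cdots$. Write $V^{-1}p=(p_1',\dots,p_n')$ and $b=\gcd(p_1',\dots,p_m')\ge 0$ (with $b=0$ if $m=0$). Let $\mathcal H=\{x\in\mathbb R^n : Ax=Ap\}$. Call $x\in\mathbb Z^n$ visible if $\gcd(x_1,\dots,x_n)=1$. Then the asymptotic density of visible lattice points on $\mathcal H$, $$\rho(\mathcal H)=\lim_{r\to\infty}\frac{\#\{x\in\mathcal H\cap[-r,r]^n\cap\mathbb Z^n : x \text{ visible}\}}{\#\big(\mathcal H\cap[-r,r]^n\cap\mathbb Z^n\big)}\qquad(r\in\mathbb R),$$ exists and $$\rho(\mathcal H)=\prod_{q\mid b}\Big(1-\frac1{q^{\,n-m}}\Big),$$ where the product is over all primes $q$ dividing $b$; when $b=0$ it is over all primes, as the limit of its finite partial products (which exists).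 If $b=0$, this value equals $1/\zeta(n-m)$ when $n-m\ge 2$, and equals $0$ when $n-m\le 1$. -/

import Mathlib

open Filter Topology

/-- An integer matrix is in Smith normal form: it vanishes off the diagonal, and the diagonal
entries `d₁, d₂, …` are nonnegative with `dᵢ ∣ dᵢ₊₁` (so the zero entries come last). -/
structure IsSmithNormalForm {s n : ℕ} (D : Matrix (Fin s) (Fin n) ℤ) : Prop where
  offDiag : ∀ (i : Fin s) (j : Fin n), (i : ℕ) ≠ (j : ℕ) → D i j = 0
  nonneg : ∀ (i : Fin s) (j : Fin n), (i : ℕ) = (j : ℕ) → 0 ≤ D i j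
  dvd : ∀ (i i' : Fin s) (j j' : Fin n), (i : ℕ) = (j : ℕ) → (i' : ℕ) = (j' : ℕ) →
    (i' : ℕ) = (i : ℕ) + 1 → D i j ∣ D i' j'

/-- A lattice point is visible (from the origin) if the gcd of its coordinates is `1`. -/
def IsVisiblePoint {n : ℕ} (x : Fin n → ℤ) : Prop :=
  Finset.univ.gcd x = 1

/-- The lattice points of `Δ ∩ [-r, r]ⁿ`. -/
def latticePoints {n : ℕ} (Δ : Set (Fin n → ℝ)) (r : ℝ) : Set (Fin n → ℤ) :=
  {x | (fun j => (x j : ℝ)) ∈ Δ ∧ ∀ j, (x j : ℝ) ∈ Set.Icc (-r) r}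

/-- The visible lattice points of `Δ ∩ [-r, r]ⁿ`. -/
def visiblePoints {n : ℕ} (Δ : Set (Fin n → ℝ)) (r : ℝ) : Set (Fin n → ℤ) :=
  {x | x ∈ latticePoints Δ r ∧ IsVisiblePoint x}

/-- `Δ` has asymptotic density of visible points equal to `ρ`: the limit, as `r → ∞`, of the
ratio of visible to all lattice points in `Δ ∩ [-r, r]ⁿ` exists and is `ρ`. -/
def HasVisibleDensity {n : ℕ} (Δ : Set (Fin n → ℝ)) (ρ : ℝ) : Prop :=
  Tendsto (fun r : ℝ => ((visiblePoints Δ r).ncard : ℝ) / ((latticePoints Δ r).ncard : ℝ))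
    atTop (𝓝 ρ)

/-- The intersection in `ℝⁿ` of the hyperplanes `∑ⱼ aᵢⱼ xⱼ = ∑ⱼ aᵢⱼ pⱼ`, i.e. the real solution
set of `A x = A p`. -/
def hyperplaneIntersection {s n : ℕ} (A : Matrix (Fin s) (Fin n) ℤ) (p : Fin n → ℤ) :
    Set (Fin n → ℝ) :=
  ⋂ i : Fin s, {x | ∑ j, (A i j : ℝ) * x j = ∑ j, (A i j : ℝ) * (p j : ℝ)}

/-- The gcd (a nonnegative integer) of the first `m` coordinates of a lattice point. -/
def gcdFirst {n : ℕ} (m : ℕ) (y : Fin n → ℤ) : ℤ :=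
  (Finset.univ.filter fun j : Fin n => (j : ℕ) < m).gcd y

/-- The factor `1 - 1 / q ^ k` at a prime `q` dividing `b` (any prime `q`, when `b = 0`). -/
noncomputable def eulerFactor (b : ℤ) (k : ℕ) (q : {q : Nat.Primes // ((q : ℕ) : ℤ) ∣ b}) : ℝ :=
  1 - 1 / (((q : Nat.Primes) : ℕ) : ℝ) ^ k

/-! In the coordinates `y = V⁻¹ x` the system `A x = A p` becomes `D y = D p'`. The nonzero diagonal
entries of `D` are exactly the first `m`, so the lattice points of the plane are `V (p'₁, …, p'ₘ,
z)` with `z ∈ ℤᵏ` free, `k = n - m`. As `V` and `V⁻¹` are integral, such a point has gcd `gcd(b, gcd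
z)`. The density is therefore that of the `z` with `gcd(b, gcd z) = 1` among those with `‖c + L z‖ ≤
t`, for an injective linear `L` and the sup norm.

The number of all such `z` is asymptotic to `v tᵏ`, where `v > 0` is a volume; those divisible by
`d` number about `v tᵏ / dᵏ`, and Möbius inversion sieves over `d`. If `b ≠ 0`, only divisors of the
radical of `b` occur: a finite sum, with no condition on `c` (`tendsto_ncard_latticeBall_coprime`).
If `b = 0`, the plane passes through the origin and `c = 0`. For `k ≥ 2` the infinite sum is handled
by dominated convergence (`tendsto_ncard_latticeBall_visible`), with limit `∑ μ(d) / dᵏ = 1 / ζ(k)`.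
For `k ≤ 1` at most two points are visible and the Euler product is `0`. -/

/-! ### Lattice points in dilated convex bodies -/

section Counting

open scoped Pointwise

variable {ι E : Type*} [Fintype ι] [NormedAddCommGroup E] [NormedSpace ℝ E]

/-- The integer vectors `w` with `‖c + δ • L w‖ ≤ t`. -/
def latticeBall (L : (ι → ℝ) →ₗ[ℝ] E) (c : E) (δ t : ℝ) : Set (ι → ℤ) :=
  {w | ‖c + δ • L (fun i => (w i : ℝ))‖ ≤ t}

theorem exists_norm_le_mul_norm_of_injective (L : (ι → ℝ) →ₗ[ℝ] E)
    (hL : Function.Injective L) : ∃ K : ℝ, 0 < K ∧ ∀ x, ‖x‖ ≤ K * ‖L x‖ := by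
  obtain ⟨K, hK, h⟩ := L.exists_antilipschitzWith (LinearMap.ker_eq_bot.mpr hL)
  refine ⟨K, hK, fun x => ?_⟩
  simpa using h.le_mul_dist x 0

theorem finite_setOf_norm_intCast_le (R : ℝ) :
    {w : ι → ℤ | ‖(fun i => (w i : ℝ))‖ ≤ R}.Finite := by
  classical
  refine (Set.finite_Icc (fun _ : ι => -⌈R⌉) (fun _ => ⌈R⌉)).subset fun w hw => ?_
  have h i : |(w i : ℝ)| ≤ ⌈R⌉ :=
    ((norm_le_pi_norm (fun i => (w i : ℝ)) i).trans hw).trans (Int.le_ceil R)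
  exact ⟨fun i => by exact_mod_cast (abs_le.mp (h i)).1,
    fun i => by exact_mod_cast (abs_le.mp (h i)).2⟩

theorem finite_latticeBall (L : (ι → ℝ) →ₗ[ℝ] E) (hL : Function.Injective L) (c : E) {δ : ℝ}
    (hδ : 0 < δ) (t : ℝ) : (latticeBall L c δ t).Finite := by
  obtain ⟨K, hK, h⟩ := exists_norm_le_mul_norm_of_injective L hL
  refine (finite_setOf_norm_intCast_le (K * ((t + ‖c‖) / δ))).subset fun w hw => ?_
  refine (h _).trans (mul_le_mul_of_nonneg_left ?_ hK.le)
  rw [le_div_iff₀' hδ]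
  have h1 : ‖δ • L (fun i => (w i : ℝ))‖ = δ * ‖L (fun i => (w i : ℝ))‖ := by
    rw [norm_smul, Real.norm_of_nonneg hδ.le]
  have h2 := norm_sub_le (c + δ • L (fun i => (w i : ℝ))) c
  rw [add_sub_cancel_left, h1] at h2
  have h3 : ‖c + δ • L (fun i => (w i : ℝ))‖ ≤ t := hw
  linarith

/-- Rescaling by `t⁻¹` fixes the body and refines the lattice, the form required by
`tendsto_card_div_pow_atTop_volume'`. -/
theorem ncard_latticeBall_zero_one (L : (ι → ℝ) →ₗ[ℝ] E) {t : ℝ} (ht : 0 < t) :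
    (latticeBall L 0 1 t).ncard =
      Nat.card ↑({x | ‖L x‖ ≤ 1} ∩
        t⁻¹ • (Submodule.span ℤ (Set.range (Pi.basisFun ℝ ι)) : Set (ι → ℝ))) := by
  have hinj : Function.Injective fun (w : ι → ℤ) => t⁻¹ • (fun i => (w i : ℝ)) := by
    intro w w' h
    ext i
    have := congrFun h i
    simpa [ht.ne'] using this
  rw [Nat.card_coe_set_eq, ← Set.ncard_image_of_injective _ hinj]
  congr 1
  ext x
  constructor
  · rintro ⟨w, hw, rfl⟩
    refine ⟨?_, Set.smul_mem_smul_set ?_⟩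
    · have hw' : ‖L (fun i => (w i : ℝ))‖ ≤ t := by simpa [latticeBall] using hw
      simp only [Set.mem_ofPred_eq, map_smul, norm_smul, norm_inv, Real.norm_of_nonneg ht.le]
      rwa [inv_mul_le_iff₀ ht, mul_one]
    · rw [SetLike.mem_coe, Module.Basis.mem_span_iff_repr_mem]
      intro i
      exact ⟨w i, by simp⟩
  · rintro ⟨hx, y, hy, rfl⟩
    rw [SetLike.mem_coe, Module.Basis.mem_span_iff_repr_mem] at hy
    choose w hw using hy
    have hwy : (fun i => (w i : ℝ)) = y := by ext i; simpa using hw i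
    refine ⟨w, ?_, by simp [hwy]⟩
    have hx' : ‖L (t⁻¹ • y)‖ ≤ 1 := hx
    rw [map_smul, norm_smul, norm_inv, Real.norm_of_nonneg ht.le, inv_mul_le_iff₀ ht,
      mul_one] at hx'
    simpa [latticeBall, hwy] using hx'

/-- The number of lattice points in a dilated centrally symmetric polytope grows like its volume. -/
theorem exists_tendsto_ncard_latticeBall_zero_one (L : (ι → ℝ) →ₗ[ℝ] E)
    (hL : Function.Injective L) : ∃ v : ℝ, 0 < v ∧
      Tendsto (fun t : ℝ => ((latticeBall L 0 1 t).ncard : ℝ) / t ^ Fintype.card ι)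
        atTop (𝓝 v) := by
  set s : Set (ι → ℝ) := {x | ‖L x‖ ≤ 1} with hs
  have hcont : Continuous L := L.continuous_of_finiteDimensional
  have hclosed : IsClosed s := isClosed_le hcont.norm continuous_const
  have hconv : Convex ℝ s := by
    have := (convex_closedBall (0 : E) 1).linear_preimage L
    simpa [Set.preimage, hs] using this
  have hbdd : Bornology.IsBounded s := by
    obtain ⟨K, hK, h⟩ := exists_norm_le_mul_norm_of_injective L hL
    refine isBounded_iff_forall_norm_le.mpr ⟨K, fun x hx => (h x).trans ?_⟩
    exact mul_le_of_le_one_right hK.le hx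
  have hnhds : s ∈ 𝓝 (0 : ι → ℝ) := by
    have ho : IsOpen {x | ‖L x‖ < 1} := isOpen_lt hcont.norm continuous_const
    exact mem_of_superset (ho.mem_nhds (by simp)) fun x (hx : ‖L x‖ < 1) => show ‖L x‖ ≤ 1 from hx.le
  have hpos : 0 < MeasureTheory.volume.real s :=
    ENNReal.toReal_pos (MeasureTheory.Measure.measure_pos_of_mem_nhds _ hnhds).ne'
      hbdd.measure_lt_top.ne
  refine ⟨_, hpos, (tendsto_card_div_pow_atTop_volume' s hbdd hclosed.measurableSet
    (hconv.addHaar_frontier _) ?_).congr' ?_⟩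
  -- The dilates of `s` increase because `s` is star-shaped about the origin.
  · rintro x y hx hxy _ ⟨z, hz, rfl⟩
    have hy : 0 < y := hx.trans_le hxy
    refine ⟨(x / y) • z, ?_, ?_⟩
    · have hz' : ‖L z‖ ≤ 1 := hz
      simp only [hs, Set.mem_ofPred_eq, map_smul, norm_smul]
      rw [Real.norm_of_nonneg (by positivity)]
      exact mul_le_one₀ ((div_le_one hy).mpr hxy) (norm_nonneg _) hz'
    · simp only [smul_smul]
      rw [mul_div_cancel₀ _ hy.ne']
  · filter_upwards [eventually_gt_atTop 0] with t ht
    rw [ncard_latticeBall_zero_one L ht]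

/-- Translating and rescaling changes the asymptotic count only by the scaling factor. -/
theorem tendsto_ncard_latticeBall (L : (ι → ℝ) →ₗ[ℝ] E) (hL : Function.Injective L) {v : ℝ}
    (hv : Tendsto (fun t : ℝ => ((latticeBall L 0 1 t).ncard : ℝ) / t ^ Fintype.card ι)
      atTop (𝓝 v)) (c : E) {δ : ℝ} (hδ : 0 < δ) :
    Tendsto (fun t : ℝ => ((latticeBall L c δ t).ncard : ℝ) / t ^ Fintype.card ι)
      atTop (𝓝 (v / δ ^ Fintype.card ι)) := by
  set k := Fintype.card ι
  -- By the triangle inequality the count lies between the centred counts at radii `(t - ‖c‖) / δ`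
  -- and `(t + ‖c‖) / δ`; the shift `e = ±‖c‖` is negligible in the limit.
  have key (e : ℝ) : Tendsto (fun t : ℝ => ((latticeBall L 0 1 ((t + e) / δ)).ncard : ℝ) / t ^ k)
      atTop (𝓝 (v / δ ^ k)) := by
    have h1 : Tendsto (fun t : ℝ => (t + e) / δ) atTop atTop :=
      (tendsto_atTop_add_const_right _ e tendsto_id).atTop_div_const hδ
    have h2 : Tendsto (fun t : ℝ => (t + e) / δ / t) atTop (𝓝 (1 / δ)) := by
      have h3 : Tendsto (fun t : ℝ => (1 + e / t) / δ) atTop (𝓝 ((1 + 0) / δ)) :=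
        ((tendsto_const_nhds.div_atTop tendsto_id).const_add 1).div_const δ
      rw [add_zero] at h3
      refine h3.congr' ?_
      filter_upwards [eventually_gt_atTop 0] with t ht
      field_simp
    have h4 := (hv.comp h1).mul (h2.pow k)
    rw [one_div, inv_pow, ← div_eq_mul_inv] at h4
    refine h4.congr' ?_
    filter_upwards [eventually_gt_atTop 0, h1.eventually_gt_atTop 0] with t ht ht'
    simp only [Function.comp_apply, div_pow ((t + e) / δ) t]
    field_simp
  have hn (w : ι → ℤ) : ‖δ • L (fun i => (w i : ℝ))‖ = δ * ‖L (fun i => (w i : ℝ))‖ := by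
    rw [norm_smul, Real.norm_of_nonneg hδ.le]
  refine tendsto_of_tendsto_of_tendsto_of_le_of_le' (key (-‖c‖)) (key ‖c‖) ?_ ?_
  · filter_upwards [eventually_gt_atTop 0] with t ht
    gcongr
    · exact finite_latticeBall L hL c hδ t
    · intro w hw
      have hw' : ‖L (fun i => (w i : ℝ))‖ ≤ (t + -‖c‖) / δ := by simpa [latticeBall] using hw
      rw [le_div_iff₀' hδ, ← hn] at hw'
      exact (norm_add_le _ _).trans (by linarith)
  · filter_upwards [eventually_gt_atTop 0] with t ht
    gcongr
    · exact finite_latticeBall L hL 0 one_pos _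
    · intro w hw
      have hw' : ‖c + δ • L (fun i => (w i : ℝ))‖ ≤ t := hw
      have h2 := norm_sub_le (c + δ • L (fun i => (w i : ℝ))) c
      rw [add_sub_cancel_left, hn] at h2
      have : ‖L (fun i => (w i : ℝ))‖ ≤ (t + ‖c‖) / δ := by
        rw [le_div_iff₀' hδ]; linarith
      simpa [latticeBall] using this

end Counting

/-! ### Möbius inversion over a finite set -/

section Moebius

open ArithmeticFunction

/-- Summing over all of `ℕ`, not over the divisors of `n`, gives every `n` the same index set, so
these sums can be added over a set of points. -/
theorem hasSum_ite_dvd_moebius {n : ℕ} (hn : n ≠ 0) :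
    HasSum (fun d : ℕ => if d ∣ n then (moebius d : ℝ) else 0) (if n = 1 then 1 else 0) := by
  have h : (∑ d ∈ n.divisors, if d ∣ n then (moebius d : ℝ) else 0) = if n = 1 then 1 else 0 := by
    rw [Finset.sum_congr rfl fun d hd => if_pos (Nat.dvd_of_mem_divisors hd)]
    have := congrArg (fun f : ArithmeticFunction ℤ => f n) moebius_mul_coe_zeta
    simp only [coe_mul_zeta_apply, one_apply] at this
    exact_mod_cast this
  rw [← h]
  refine hasSum_sum_of_ne_finset_zero fun d hd => if_neg fun hdn => hd ?_
  exact Nat.mem_divisors.mpr ⟨hdn, hn⟩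

/-- Möbius inversion for counting the elements of a finite set at which a positive
integer-valued function equals `1`. -/
theorem hasSum_moebius_mul_ncard {α : Type*} {T : Set α} (hT : T.Finite) {g : α → ℕ}
    (hg : ∀ w ∈ T, g w ≠ 0) :
    HasSum (fun d : ℕ => (moebius d : ℝ) * ({w | w ∈ T ∧ d ∣ g w}.ncard : ℝ))
      ({w | w ∈ T ∧ g w = 1}.ncard : ℝ) := by
  classical
  lift T to Finset α using hT
  have hcard (P : α → Prop) : ({w | w ∈ (T : Set α) ∧ P w}.ncard : ℝ)
      = ∑ w ∈ T, if P w then (1 : ℝ) else 0 := by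
    rw [Finset.sum_boole, ← Set.ncard_coe_finset]
    simp
  simp_rw [hcard, Finset.mul_sum, mul_ite, mul_one, mul_zero]
  exact hasSum_sum fun w hw => by convert hasSum_ite_dvd_moebius (hg w hw)

end Moebius

/-! ### Sieving by the gcd of the coordinates -/

section Divisibility

variable {ι E : Type*} [Fintype ι] [NormedAddCommGroup E] [NormedSpace ℝ E]

theorem natCast_dvd_natAbs_gcd_iff (w : ι → ℤ) (d : ℕ) :
    d ∣ (Finset.univ.gcd w).natAbs ↔ ∀ i, (d : ℤ) ∣ w i := by
  rw [← Int.natCast_dvd, Finset.dvd_gcd_iff]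
  simp

/-- Writing `w = d u` moves the factor `d` into the scaling of `L` and leaves the centre `c` alone.
-/
theorem ncard_latticeBall_dvd (L : (ι → ℝ) →ₗ[ℝ] E) (c : E) {d : ℕ} (hd : d ≠ 0) (t : ℝ) :
    {w | w ∈ latticeBall L c 1 t ∧ d ∣ (Finset.univ.gcd w).natAbs}.ncard
      = (latticeBall L c d t).ncard := by
  have hinj : Function.Injective fun (w : ι → ℤ) i => (d : ℤ) * w i := fun w w' h => by
    ext i
    simpa [hd] using congrFun h i
  have hL (w : ι → ℤ) : L (fun i => (((d : ℤ) * w i : ℤ) : ℝ)) = (d : ℝ) • L (fun i => (w i : ℝ)) := by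
    rw [← map_smul]
    congr 1
    ext i
    simp
  rw [← Set.ncard_image_of_injective (latticeBall L c d t) hinj]
  congr 1
  ext w
  simp only [natCast_dvd_natAbs_gcd_iff]
  constructor
  · rintro ⟨hw, hdw⟩
    choose u hu using hdw
    obtain rfl : w = fun i => (d : ℤ) * u i := funext hu
    refine ⟨u, ?_, rfl⟩
    have hw' : ‖c + (1 : ℝ) • L (fun i => (((d : ℤ) * u i : ℤ) : ℝ))‖ ≤ t := hw
    rwa [one_smul, hL] at hw'
  · rintro ⟨u, hu, rfl⟩
    refine ⟨?_, fun i => dvd_mul_right _ _⟩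
    change ‖c + (1 : ℝ) • L (fun i => (((d : ℤ) * u i : ℤ) : ℝ))‖ ≤ t
    rw [one_smul, hL]
    exact hu

open ArithmeticFunction in
/-- The asymptotic count of lattice points whose gcd is coprime to a squarefree number. -/
theorem tendsto_ncard_latticeBall_coprime (L : (ι → ℝ) →ₗ[ℝ] E) (hL : Function.Injective L)
    {v : ℝ}
    (hv : Tendsto (fun t : ℝ => ((latticeBall L 0 1 t).ncard : ℝ) / t ^ Fintype.card ι)
      atTop (𝓝 v)) (c : E) {N : ℕ} (hN : Squarefree N) :
    Tendsto (fun t : ℝ => ({w | w ∈ latticeBall L c 1 t ∧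
        N.gcd (Finset.univ.gcd w).natAbs = 1}.ncard : ℝ) / t ^ Fintype.card ι)
      atTop (𝓝 (v * ∏ q ∈ N.primeFactors, (1 - 1 / (q : ℝ) ^ Fintype.card ι))) := by
  set k := Fintype.card ι
  have hcount (t : ℝ) : ({w | w ∈ latticeBall L c 1 t ∧
        N.gcd (Finset.univ.gcd w).natAbs = 1}.ncard : ℝ)
      = ∑ d ∈ N.divisors, (moebius d : ℝ) * ((latticeBall L c d t).ncard : ℝ) := by
    have h := hasSum_moebius_mul_ncard (finite_latticeBall L hL c one_pos t)
      (g := fun w => N.gcd (Finset.univ.gcd w).natAbs)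
      fun w _ => Nat.gcd_ne_zero_left hN.ne_zero
    rw [← h.tsum_eq, tsum_eq_sum (s := N.divisors)]
    · refine Finset.sum_congr rfl fun d hd => ?_
      have hdN := Nat.dvd_of_mem_divisors hd
      rw [← ncard_latticeBall_dvd L c (ne_zero_of_dvd_ne_zero hN.ne_zero hdN)]
      simp only [Nat.dvd_gcd_iff, hdN, true_and]
    · intro d hd
      have : ¬ d ∣ N := fun h => hd (Nat.mem_divisors.mpr ⟨h, hN.ne_zero⟩)
      simp [Nat.dvd_gcd_iff, this]
  -- The value at `0` is imposed separately because `1 / 0 ^ k` is `1` when `k = 0`.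
  let f : ArithmeticFunction ℝ := ⟨fun d => if d = 0 then 0 else 1 / (d : ℝ) ^ k, by simp⟩
  have hf {d : ℕ} (hd : d ≠ 0) : f d = 1 / (d : ℝ) ^ k := if_neg hd
  have hfmul : f.IsMultiplicative := by
    refine IsMultiplicative.iff_ne_zero.mpr ⟨by simp [hf], fun {m n} hm hn _ => ?_⟩
    rw [hf hm, hf hn, hf (mul_ne_zero hm hn)]
    push_cast
    rw [mul_pow]
    field_simp
  have hprod : ∏ q ∈ N.primeFactors, (1 - 1 / (q : ℝ) ^ k)
      = ∑ d ∈ N.divisors, (moebius d : ℝ) * (1 / (d : ℝ) ^ k) := by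
    have h := hfmul.prodPrimeFactors_one_sub_of_squarefree f hN
    rw [Finset.prod_congr rfl fun q hq => by rw [hf (Nat.prime_of_mem_primeFactors hq).ne_zero],
      Finset.sum_congr rfl fun d hd => by
        rw [hf (ne_zero_of_dvd_ne_zero hN.ne_zero (Nat.dvd_of_mem_divisors hd))]] at h
    exact h
  simp_rw [hcount, Finset.sum_div, hprod, Finset.mul_sum]
  refine tendsto_finsetSum _ fun d hd => ?_
  have hd0 : (0 : ℝ) < d := by
    exact_mod_cast Nat.pos_of_mem_divisors hd
  have := (tendsto_ncard_latticeBall L hL hv c hd0).const_mul (moebius d : ℝ)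
  convert this using 2 <;> ring

/-- The number of nonzero lattice points is uniformly bounded by a multiple of the volume. -/
theorem exists_ncard_latticeBall_diff_zero_le (L : (ι → ℝ) →ₗ[ℝ] E) (hL : Function.Injective L)
    {v : ℝ}
    (hv : Tendsto (fun t : ℝ => ((latticeBall L 0 1 t).ncard : ℝ) / t ^ Fintype.card ι)
      atTop (𝓝 v)) :
    ∃ C : ℝ, ∀ t : ℝ, 0 < t →
      ((latticeBall L 0 1 t \ {0}).ncard : ℝ) ≤ C * t ^ Fintype.card ι := by
  set k := Fintype.card ι
  obtain ⟨K, hK, hKL⟩ := exists_norm_le_mul_norm_of_injective L hL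
  obtain ⟨t₀, ht₀⟩ := eventually_atTop.mp (hv.eventually_le_const (lt_add_one v))
  set M : ℝ := ((latticeBall L 0 1 t₀).ncard : ℝ)
  -- For `t ≥ t₀` the limit gives `v + 1`. For `t < t₀`, either `K t < 1` and only the origin
  -- remains, since a nonzero integer vector has sup norm at least `1`, or the count is at most `M ≤
  -- M (K t)ᵏ`.
  refine ⟨max (v + 1) (M * K ^ k), fun t ht => ?_⟩
  rcases le_or_gt t₀ t with h | h
  · have h1 := ht₀ t h
    rw [div_le_iff₀ (by positivity)] at h1
    calc ((latticeBall L 0 1 t \ {0}).ncard : ℝ) ≤ (latticeBall L 0 1 t).ncard := by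
          gcongr
          · exact finite_latticeBall L hL 0 one_pos t
          · exact Set.sdiff_subset
      _ ≤ (v + 1) * t ^ k := h1
      _ ≤ _ := by gcongr; exact le_max_left _ _
  · rcases lt_or_ge (K * t) 1 with h1 | h1
    · have : latticeBall L 0 1 t \ {0} = ∅ := by
        refine Set.eq_empty_of_forall_notMem fun w hw => hw.2 ?_
        have hw1 : ‖L (fun i => (w i : ℝ))‖ ≤ t := by simpa [latticeBall] using hw.1
        have hw2 : ‖(fun i => (w i : ℝ))‖ < 1 :=
          ((hKL _).trans (mul_le_mul_of_nonneg_left hw1 hK.le)).trans_lt h1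
        ext i
        have hi : |(w i : ℝ)| < 1 := (norm_le_pi_norm (fun i => (w i : ℝ)) i).trans_lt hw2
        have hi' : |w i| < 1 := by exact_mod_cast hi
        simpa using Int.abs_lt_one_iff.mp hi'
      rw [this, Set.ncard_empty, Nat.cast_zero]
      have : 0 ≤ M * K ^ k := by positivity
      have := this.trans (le_max_right (v + 1) _)
      positivity
    · calc ((latticeBall L 0 1 t \ {0}).ncard : ℝ) ≤ M := by
            refine Nat.cast_le.mpr (Set.ncard_le_ncard ?_ (finite_latticeBall L hL 0 one_pos t₀))
            exact fun w hw => le_trans (b := t) hw.1 h.le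
        _ ≤ M * (K * t) ^ k := le_mul_of_one_le_right (by positivity) (one_le_pow₀ h1)
        _ = M * K ^ k * t ^ k := by rw [mul_pow, mul_assoc]
        _ ≤ _ := by gcongr; exact le_max_right _ _

open ArithmeticFunction in
/-- The asymptotic count of visible lattice points in a lattice of rank at least two. -/
theorem tendsto_ncard_latticeBall_visible (L : (ι → ℝ) →ₗ[ℝ] E) (hL : Function.Injective L)
    {v : ℝ}
    (hv : Tendsto (fun t : ℝ => ((latticeBall L 0 1 t).ncard : ℝ) / t ^ Fintype.card ι)
      atTop (𝓝 v)) (hk : 2 ≤ Fintype.card ι) :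
    Tendsto (fun t : ℝ => ({w | w ∈ latticeBall L 0 1 t ∧
        (Finset.univ.gcd w).natAbs = 1}.ncard : ℝ) / t ^ Fintype.card ι)
      atTop (𝓝 (v * ∑' d : ℕ, (moebius d : ℝ) * (1 / (d : ℝ) ^ Fintype.card ι))) := by
  have hk0 : Fintype.card ι ≠ 0 := by omega
  obtain ⟨C, hC⟩ := exists_ncard_latticeBall_diff_zero_le L hL hv
  set k := Fintype.card ι
  -- The origin is divisible by every `d`: it would add `1` to each term and rule out a bound by a
  -- multiple of `(t / d)ᵏ` uniform in `d`.
  set G : ℝ → ℝ := fun t => ((latticeBall L 0 1 t \ {0}).ncard : ℝ) with hG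
  have hzero {t : ℝ} (ht : 0 ≤ t) : (0 : ι → ℤ) ∈ latticeBall L 0 1 t := by
    have : (fun i => (((0 : ι → ℤ) i : ℤ) : ℝ)) = 0 := by ext; simp
    change ‖(0 : E) + (1 : ℝ) • L (fun i => (((0 : ι → ℤ) i : ℤ) : ℝ))‖ ≤ t
    rw [this]
    simpa using ht
  have hGv : Tendsto (fun t => G t / t ^ k) atTop (𝓝 v) := by
    have h1 : Tendsto (fun t : ℝ => 1 / t ^ k) atTop (𝓝 0) :=
      tendsto_const_nhds.div_atTop (tendsto_pow_atTop hk0)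
    have h2 := hv.sub h1
    rw [sub_zero] at h2
    refine h2.congr' ?_
    filter_upwards [eventually_ge_atTop 0] with t ht
    have := Set.ncard_sdiff_singleton_add_one (hzero ht) (finite_latticeBall L hL 0 one_pos t)
    rw [hG, ← this]
    push_cast
    ring
  have hdvd {d : ℕ} (hd : d ≠ 0) (t : ℝ) :
      ({w | w ∈ latticeBall L 0 1 t \ {0} ∧ d ∣ (Finset.univ.gcd w).natAbs}.ncard : ℝ)
        = G (t / d) := by
    have hd0 : (0 : ℝ) < d := by exact_mod_cast Nat.pos_of_ne_zero hd
    have hball : latticeBall L 0 d t = latticeBall L 0 1 (t / d) := by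
      ext w
      change ‖_‖ ≤ t ↔ ‖_‖ ≤ t / d
      rw [zero_add, zero_add, one_smul, norm_smul, Real.norm_of_nonneg hd0.le, le_div_iff₀' hd0]
    rcases lt_or_ge t 0 with ht | ht
    · have he {s : ℝ} (hs : s < 0) : latticeBall L 0 1 s = ∅ :=
        Set.eq_empty_of_forall_notMem fun w hw => (norm_nonneg _).not_gt (lt_of_le_of_lt hw hs)
      rw [hG]
      simp [he ht, he (div_neg_of_neg_of_pos ht hd0)]
    · have h1 := ncard_latticeBall_dvd L 0 hd t
      rw [hball] at h1
      have hsub : {w | w ∈ latticeBall L 0 1 t \ {0} ∧ d ∣ (Finset.univ.gcd w).natAbs}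
          = {w | w ∈ latticeBall L 0 1 t ∧ d ∣ (Finset.univ.gcd w).natAbs} \ {0} := by
        ext w
        simp only [Set.mem_ofPred_eq, Set.mem_sdiff, and_right_comm]
      rw [hsub, hG]
      dsimp only
      rw [Set.ncard_sdiff_singleton_of_mem, Set.ncard_sdiff_singleton_of_mem, h1]
      · exact hzero (by positivity)
      · exact ⟨hzero ht, by simp [natCast_dvd_natAbs_gcd_iff]⟩
  have hcount (t : ℝ) : ({w | w ∈ latticeBall L 0 1 t ∧
        (Finset.univ.gcd w).natAbs = 1}.ncard : ℝ) = ∑' d : ℕ, (moebius d : ℝ) * G (t / d) := by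
    have h := hasSum_moebius_mul_ncard (T := latticeBall L 0 1 t \ {0})
      (finite_latticeBall L hL 0 one_pos t).sdiff
      (g := fun w => (Finset.univ.gcd w).natAbs) fun w hw h0 => hw.2 (by
        rw [Int.natAbs_eq_zero, Finset.gcd_eq_zero_iff] at h0
        exact funext fun i => h0 i (Finset.mem_univ i))
    have hset : {w | w ∈ latticeBall L 0 1 t ∧ (Finset.univ.gcd w).natAbs = 1}
        = {w | w ∈ latticeBall L 0 1 t \ {0} ∧ (Finset.univ.gcd w).natAbs = 1} := by
      ext w
      simp only [Set.mem_ofPred_eq, Set.mem_sdiff, Set.mem_singleton_iff]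
      refine ⟨fun hw => ⟨⟨hw.1, ?_⟩, hw.2⟩, fun hw => ⟨hw.1.1, hw.2⟩⟩
      rintro rfl
      have : Finset.univ.gcd (0 : ι → ℤ) = 0 := Finset.gcd_eq_zero_iff.mpr fun _ _ => rfl
      simp [this] at hw
    rw [hset, ← h.tsum_eq]
    refine tsum_congr fun d => ?_
    rcases eq_or_ne d 0 with rfl | hd
    · simp
    · rw [hdvd hd]
  simp_rw [hcount, ← tsum_div_const, ← tsum_mul_left]
  -- The uniform bound at radius `t / d` and `|μ(d)| ≤ 1` dominate the `d`-th term by `C / dᵏ`,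
  -- summable because `k ≥ 2`.
  refine tendsto_tsum_of_dominated_convergence (bound := fun d : ℕ => C * (1 / (d : ℝ) ^ k))
    ((Real.summable_one_div_nat_pow.mpr (by omega)).mul_left C) (fun d => ?_) ?_
  · rcases eq_or_ne d 0 with rfl | hd
    · simp
    have hd0 : (0 : ℝ) < d := by exact_mod_cast Nat.pos_of_ne_zero hd
    have h1 := (hGv.comp (tendsto_id.atTop_div_const hd0)).const_mul
      ((moebius d : ℝ) * (1 / (d : ℝ) ^ k))
    have h2 : v * ((moebius d : ℝ) * (1 / (d : ℝ) ^ k))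
      = (moebius d : ℝ) * (1 / (d : ℝ) ^ k) * v := by ring
    rw [h2]
    refine h1.congr' ?_
    filter_upwards [eventually_gt_atTop 0] with t ht
    simp only [Function.comp_apply, id, div_pow]
    field_simp
  · filter_upwards [eventually_gt_atTop 0] with t ht d
    rcases eq_or_ne d 0 with rfl | hd
    · simp [zero_pow hk0]
    have hd0 : (0 : ℝ) < d := by exact_mod_cast Nat.pos_of_ne_zero hd
    have hGnn : 0 ≤ G (t / d) := Nat.cast_nonneg _
    have hmu : |(moebius d : ℝ)| ≤ 1 := by exact_mod_cast abs_moebius_le_one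
    rw [norm_div, norm_mul, Real.norm_of_nonneg hGnn, Real.norm_of_nonneg (pow_pos ht k).le,
      div_le_iff₀ (by positivity), Real.norm_eq_abs]
    calc |(moebius d : ℝ)| * G (t / d) ≤ G (t / d) := mul_le_of_le_one_left hGnn hmu
      _ ≤ C * (t / d) ^ k := hC _ (by positivity)
      _ = _ := by rw [div_pow]; ring

/-- In a lattice of rank at most one the visible lattice points have density zero. -/
theorem tendsto_ncard_latticeBall_visible_div_of_card_le_one (L : (ι → ℝ) →ₗ[ℝ] E)
    {v : ℝ} (hv0 : 0 < v)
    (hv : Tendsto (fun t : ℝ => ((latticeBall L 0 1 t).ncard : ℝ) / t ^ Fintype.card ι)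
      atTop (𝓝 v)) (hk : Fintype.card ι ≤ 1) :
    Tendsto (fun t : ℝ => ({w | w ∈ latticeBall L 0 1 t ∧
        (Finset.univ.gcd w).natAbs = 1}.ncard : ℝ) / ((latticeBall L 0 1 t).ncard : ℝ))
      atTop (𝓝 0) := by
  rcases Nat.lt_or_ge (Fintype.card ι) 1 with h0 | h1
  -- In rank `0` the gcd of the empty family is `0`, so no point is counted.
  · have : IsEmpty ι := Fintype.card_eq_zero_iff.mp (by omega)
    simp
  · have hk1 : Fintype.card ι = 1 := le_antisymm hk h1
    obtain ⟨i, hi⟩ := Fintype.card_eq_one_iff.mp hk1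
    have hsub (t : ℝ) : ({w | w ∈ latticeBall L 0 1 t ∧
        (Finset.univ.gcd w).natAbs = 1}.ncard : ℝ) ≤ 2 := by
      have h2 : ({fun _ => 1, fun _ => -1} : Set (ι → ℤ)).ncard ≤ 2 := (Set.ncard_insert_le _ _).trans (by simp)
      refine le_trans (Nat.cast_le.mpr (Set.ncard_le_ncard ?_ (Set.toFinite _)))
        (by exact_mod_cast h2)
      rintro w ⟨-, hw⟩
      have huw : w i ∣ 1 := by
        have : (w i).natAbs ∣ (Finset.univ.gcd w).natAbs := by
          rw [natCast_dvd_natAbs_gcd_iff]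
          intro j
          rw [hi j, Int.natCast_dvd]
        rw [hw] at this
        exact Int.natAbs_dvd_natAbs.mp this
      rcases Int.isUnit_iff.mp (isUnit_of_dvd_one huw) with h | h
      · exact Or.inl (funext fun j => (hi j ▸ h : w j = _))
      · exact Or.inr (funext fun j => (hi j ▸ h : w j = _))
    have htop : Tendsto (fun t : ℝ => ((latticeBall L 0 1 t).ncard : ℝ)) atTop atTop := by
      refine (hv.pos_mul_atTop hv0 (tendsto_pow_atTop (n := Fintype.card ι) (by omega))).congr' ?_
      filter_upwards [eventually_gt_atTop 0] with t ht
      field_simp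
    refine squeeze_zero (fun t => by positivity) (fun t => ?_)
      ((tendsto_const_nhds (x := (2 : ℝ))).div_atTop htop)
    gcongr
    exact hsub t

end Divisibility

/-! ### Euler products over all primes -/

section EulerProduct

open ArithmeticFunction

theorem ofReal_tsum_moebius_mul_one_div_pow {k : ℕ} (hk : 2 ≤ k) :
    ((∑' d : ℕ, (moebius d : ℝ) * (1 / (d : ℝ) ^ k) : ℝ) : ℂ) = 1 / riemannZeta (k : ℂ) := by
  have hs : 1 < (k : ℂ).re := by simpa using Nat.lt_of_succ_le hk
  have h := LSeries_zeta_mul_Lseries_moebius hs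
  rw [LSeries_zeta_eq_riemannZeta hs] at h
  rw [← eq_one_div_of_mul_eq_one_right h, Complex.ofReal_tsum]
  refine tsum_congr fun d => ?_
  rcases eq_or_ne d 0 with rfl | hd
  · simp
  · rw [LSeries.term_of_ne_zero hd, Complex.cpow_natCast]
    push_cast
    ring

/-- Invert the Euler product of `ζ(k) ≠ 0` and take real parts; the partial products are already
real. -/
theorem hasProd_primes_one_sub_one_div_pow {k : ℕ} (hk : 2 ≤ k) :
    HasProd (fun q : Nat.Primes => 1 - 1 / ((q : ℕ) : ℝ) ^ k)
      (∑' d : ℕ, (moebius d : ℝ) * (1 / (d : ℝ) ^ k)) := by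
  have hs : 1 < (k : ℂ).re := by simpa using Nat.lt_of_succ_le hk
  have h := (riemannZeta_eulerProduct_hasProd hs).inv₀ (riemannZeta_ne_zero_of_one_lt_re hs)
  rw [← one_div, ← ofReal_tsum_moebius_mul_one_div_pow hk] at h
  have h2 := (Complex.continuous_re.tendsto _).comp h
  rw [Complex.ofReal_re] at h2
  refine h2.congr fun s => ?_
  have : ∏ q ∈ s, ((1 - ((q : ℕ) : ℂ) ^ (-(k : ℂ)))⁻¹)⁻¹
      = ((∏ q ∈ s, (1 - 1 / ((q : ℕ) : ℝ) ^ k) : ℝ) : ℂ) := by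
    rw [Complex.ofReal_prod]
    refine Finset.prod_congr rfl fun q _ => ?_
    rw [inv_inv, Complex.cpow_neg, Complex.cpow_natCast]
    push_cast
    ring
  rw [Function.comp_apply, this, Complex.ofReal_re]

/-- For `k = 0` every factor vanishes. For `k = 1`, `1 - x ≤ exp (-x)` and the divergence of `∑ 1 /
q` over the primes force the limit `0`. -/
theorem hasProd_primes_one_sub_one_div_pow_of_le_one {k : ℕ} (hk : k ≤ 1) :
    HasProd (fun q : Nat.Primes => 1 - 1 / ((q : ℕ) : ℝ) ^ k) 0 := by
  rcases Nat.le_one_iff_eq_zero_or_eq_one.mp hk with rfl | rfl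
  · refine tendsto_const_nhds.congr' ?_
    filter_upwards [eventually_ge_atTop {⟨2, Nat.prime_two⟩}] with s hs
    exact (Finset.prod_eq_zero (hs (Finset.mem_singleton_self _)) (by simp)).symm
  · have hdiv : Tendsto (fun s : Finset Nat.Primes => ∑ q ∈ s, (1 / ((q : ℕ) : ℝ)))
        atTop atTop := by
      refine (tendsto_atTop_of_monotone fun s t hst => ?_).resolve_right fun ⟨a, ha⟩ =>
        Nat.Primes.not_summable_one_div (HasSum.summable (a := a) ha)
      exact Finset.sum_le_sum_of_subset_of_nonneg hst fun _ _ _ => by positivity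
    refine squeeze_zero (fun s => Finset.prod_nonneg fun q _ => ?_) (fun s => ?_)
      (Real.tendsto_exp_neg_atTop_nhds_zero.comp hdiv)
    · have : (1 : ℝ) ≤ ((q : ℕ) : ℝ) := by exact_mod_cast q.prop.one_lt.le
      rw [pow_one, sub_nonneg]
      exact (div_le_one (by positivity)).mpr this
    · have hq (q : Nat.Primes) : 0 ≤ 1 - 1 / ((q : ℕ) : ℝ) ^ 1 := by
        have : (1 : ℝ) ≤ ((q : ℕ) : ℝ) := by exact_mod_cast q.prop.one_lt.le
        rw [pow_one, sub_nonneg]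
        exact (div_le_one (by positivity)).mpr this
      rw [Function.comp_apply, ← Finset.sum_neg_distrib, Real.exp_sum]
      refine Finset.prod_le_prod (fun q _ => hq q) fun q _ => ?_
      rw [pow_one]
      exact Real.one_sub_le_exp_neg _

end EulerProduct

/-! ### Euler products over the primes dividing `b` -/

section EulerFactor

theorem hasProd_eulerFactor_zero_iff {k : ℕ} {a : ℝ} :
    HasProd (eulerFactor 0 k) a ↔
      HasProd (fun q : Nat.Primes => 1 - 1 / ((q : ℕ) : ℝ) ^ k) a := by
  rw [← (Equiv.subtypeUnivEquiv fun q : Nat.Primes => dvd_zero ((q : ℕ) : ℤ)).hasProd_iff]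
  rfl

theorem hasProd_eulerFactor_of_ne_zero {b : ℤ} (hb : b ≠ 0) (k : ℕ) :
    HasProd (eulerFactor b k) (∏ q ∈ b.natAbs.primeFactors, (1 - 1 / (q : ℝ) ^ k)) := by
  have hb' : b.natAbs ≠ 0 := Int.natAbs_ne_zero.mpr hb
  let e : {q : Nat.Primes // ((q : ℕ) : ℤ) ∣ b} ≃ b.natAbs.primeFactors :=
    { toFun := fun q => ⟨q.1, Nat.mem_primeFactors.mpr ⟨q.1.2, Int.natCast_dvd.mp q.2, hb'⟩⟩
      invFun := fun q => ⟨⟨q.1, Nat.prime_of_mem_primeFactors q.2⟩,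
        Int.natCast_dvd.mpr (Nat.dvd_of_mem_primeFactors q.2)⟩
      left_inv := fun _ => rfl
      right_inv := fun _ => rfl }
  rw [← Finset.prod_coe_sort, ← e.symm.hasProd_iff]
  exact hasProd_fintype _

end EulerFactor

/-! ### Rank and kernel of a Smith normal form -/

section SmithNormalForm

variable {s n : ℕ}

/-- The nonzero diagonal entries of a matrix in Smith normal form are the first ones. -/
theorem IsSmithNormalForm.ne_zero_of_le {D : Matrix (Fin s) (Fin n) ℤ} (hD : IsSmithNormalForm D)
    {i i' : Fin s} {j j' : Fin n} (hij : (i : ℕ) = j) (hij' : (i' : ℕ) = j') (hle : i' ≤ i)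
    (h : D i j ≠ 0) : D i' j' ≠ 0 := by
  have key (l a : ℕ) (hs : a + l < s) (hn : a + l < n) :
      D ⟨a, by omega⟩ ⟨a, by omega⟩ ∣ D ⟨a + l, hs⟩ ⟨a + l, hn⟩ := by
    induction l with
    | zero => exact dvd_rfl
    | succ l ih =>
      exact (ih (by omega) (by omega)).trans (hD.dvd _ _ _ _ rfl rfl rfl)
  obtain ⟨l, hl⟩ := Nat.exists_eq_add_of_le (Fin.le_def.mp hle)
  have hk := key l i' (hl ▸ i.2) (by have := j.2; omega)
  have e1 : (⟨i', i'.2⟩ : Fin s) = i' := rfl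
  have e2 : (⟨i', by have := j'.2; omega⟩ : Fin n) = j' := Fin.ext hij'
  have e3 : (⟨i' + l, hl ▸ i.2⟩ : Fin s) = i := Fin.ext hl.symm
  have e4 : (⟨i' + l, by have := j.2; omega⟩ : Fin n) = j := Fin.ext (by simp only; omega)
  rw [e1, e2, e3, e4] at hk
  exact ne_zero_of_dvd_ne_zero h hk

theorem IsSmithNormalForm.exists_forall_ne_zero_iff {D : Matrix (Fin s) (Fin n) ℤ}
    (hD : IsSmithNormalForm D) : ∃ t : ℕ, t ≤ s ∧ t ≤ n ∧
      ∀ (i : Fin s) (j : Fin n), (i : ℕ) = j → (D i j ≠ 0 ↔ (j : ℕ) < t) := by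
  classical
  -- Outside the matrix `P` holds vacuously, so its least element exists, is at most `s` and `n`,
  -- and is the length of the initial run of nonzero diagonal entries.
  let P : ℕ → Prop := fun a => ∀ (hs : a < s) (hn : a < n), D ⟨a, hs⟩ ⟨a, hn⟩ = 0
  have hP : ∃ a, P a := ⟨s, fun hs => absurd hs (lt_irrefl _)⟩
  refine ⟨Nat.find hP, Nat.find_le fun hs => absurd hs (lt_irrefl _),
    Nat.find_le fun _ hn => absurd hn (lt_irrefl _), fun i j hij => ⟨fun h => ?_, fun h => ?_⟩⟩
  · by_contra! hle
    have hspec := Nat.find_spec hP (by have := i.2; omega) (by have := j.2; omega)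
    exact hD.ne_zero_of_le hij rfl (Fin.le_def.mpr (by simp only; omega)) h hspec
  · have := Nat.find_min hP h
    simp only [P, not_forall] at this
    obtain ⟨hs, hn, h⟩ := this
    have e : (⟨j, hs⟩ : Fin s) = i := Fin.ext hij.symm
    rwa [e] at h

theorem IsSmithNormalForm.mulVec_apply {D : Matrix (Fin s) (Fin n) ℤ} (hD : IsSmithNormalForm D)
    (y : Fin n → ℤ) {i : Fin s} {j : Fin n} (hij : (i : ℕ) = j) :
    D.mulVec y i = D i j * y j := by
  rw [Matrix.mulVec, dotProduct, Finset.sum_eq_single j]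
  · intro j' _ hne
    rw [hD.offDiag i j' fun h => hne (Fin.ext (by omega)), zero_mul]
  · simp

theorem IsSmithNormalForm.mulVec_apply_eq_zero {D : Matrix (Fin s) (Fin n) ℤ}
    (hD : IsSmithNormalForm D) (y : Fin n → ℤ) {i : Fin s} (hi : n ≤ i) :
    D.mulVec y i = 0 := by
  rw [Matrix.mulVec, dotProduct]
  refine Finset.sum_eq_zero fun j _ => ?_
  rw [hD.offDiag i j (by have := j.2; omega), zero_mul]

/-- A diagonal entry of a matrix in Smith normal form is nonzero exactly when its index is less
than the rank. -/
theorem IsSmithNormalForm.ne_zero_iff_lt_rank {D : Matrix (Fin s) (Fin n) ℤ}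
    (hD : IsSmithNormalForm D) : D.rank ≤ s ∧
      ∀ (i : Fin s) (j : Fin n), (i : ℕ) = j → (D i j ≠ 0 ↔ (j : ℕ) < D.rank) := by
  obtain ⟨t, hts, htn, ht⟩ := hD.exists_forall_ne_zero_iff
  suffices h : D.rank = t by rw [h]; exact ⟨hts, ht⟩
  -- Restricting `D` to the first `t` coordinates keeps its range and makes it injective, so the
  -- rank is `t`.
  let ext : (Fin t → ℤ) →ₗ[ℤ] (Fin n → ℤ) :=
    { toFun := fun z j => if h : (j : ℕ) < t then z ⟨j, h⟩ else 0
      map_add' := fun x y => by ext j; by_cases h : (j : ℕ) < t <;> simp [h]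
      map_smul' := fun a x => by ext j; by_cases h : (j : ℕ) < t <;> simp [h] }
  have hext (z : Fin t → ℤ) (j : Fin n) (h : (j : ℕ) < t) : ext z j = z ⟨j, h⟩ := dif_pos h
  have hinj : Function.Injective (D.mulVecLin ∘ₗ ext) := by
    rw [← LinearMap.ker_eq_bot, LinearMap.ker_eq_bot']
    intro z hz
    ext a
    have h1 : D.mulVec (ext z) ⟨a, by omega⟩ = 0 := congrFun hz _
    rw [hD.mulVec_apply (ext z) (j := ⟨a, by omega⟩) rfl, hext z ⟨a, by omega⟩ a.2] at h1
    exact (mul_eq_zero.mp h1).resolve_left ((ht _ _ rfl).mpr a.2)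
  have hrange : LinearMap.range D.mulVecLin = LinearMap.range (D.mulVecLin ∘ₗ ext) := by
    refine le_antisymm ?_ (LinearMap.range_comp_le_range _ _)
    rintro _ ⟨y, rfl⟩
    refine ⟨fun a => y ⟨a, by omega⟩, ?_⟩
    ext i
    change D.mulVec (ext _) i = D.mulVec y i
    rcases lt_or_ge (i : ℕ) n with hi | hi
    · rw [hD.mulVec_apply _ (j := ⟨i, hi⟩) rfl, hD.mulVec_apply _ (j := ⟨i, hi⟩) rfl]
      rcases lt_or_ge (i : ℕ) t with hit | hit
      · rw [hext _ _ hit]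
      · have : D i ⟨i, hi⟩ = 0 := not_not.mp fun h => ((ht i ⟨i, hi⟩ rfl).mp h).not_ge hit
        rw [this, zero_mul, zero_mul]
    · rw [hD.mulVec_apply_eq_zero _ hi, hD.mulVec_apply_eq_zero _ hi]
  rw [Matrix.rank, hrange, LinearMap.finrank_range_of_inj hinj, Module.finrank_fin_fun]

theorem IsSmithNormalForm.mulVec_eq_mulVec_iff {D : Matrix (Fin s) (Fin n) ℤ}
    (hD : IsSmithNormalForm D) (y y' : Fin n → ℤ) :
    D.mulVec y = D.mulVec y' ↔ ∀ j : Fin n, (j : ℕ) < D.rank → y j = y' j := by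
  obtain ⟨hs, h⟩ := hD.ne_zero_iff_lt_rank
  constructor
  · intro he j hj
    have h1 := congrFun he ⟨j, hj.trans_le hs⟩
    rw [hD.mulVec_apply y (j := j) rfl, hD.mulVec_apply y' (j := j) rfl] at h1
    exact mul_left_cancel₀ ((h _ _ rfl).mpr hj) h1
  · intro he
    ext i
    rcases lt_or_ge (i : ℕ) n with hi | hi
    · rw [hD.mulVec_apply _ (j := ⟨i, hi⟩) rfl, hD.mulVec_apply _ (j := ⟨i, hi⟩) rfl]
      by_cases hd : D i ⟨i, hi⟩ = 0
      · rw [hd, zero_mul, zero_mul]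
      · rw [he _ ((h i ⟨i, hi⟩ rfl).mp hd)]
    · rw [hD.mulVec_apply_eq_zero _ hi, hD.mulVec_apply_eq_zero _ hi]

end SmithNormalForm

/-! ### Unimodular changes of coordinates and the gcd -/

section Unimodular

variable {n : ℕ}

theorem forall_dvd_mulVec_iff (V : Matrix.GeneralLinearGroup (Fin n) ℤ) (y : Fin n → ℤ) (d : ℤ) :
    (∀ j, d ∣ (V : Matrix (Fin n) (Fin n) ℤ).mulVec y j) ↔ ∀ j, d ∣ y j := by
  have key (W : Matrix (Fin n) (Fin n) ℤ) (y : Fin n → ℤ) (h : ∀ j, d ∣ y j) (j : Fin n) :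
      d ∣ W.mulVec y j := by
    rw [Matrix.mulVec, dotProduct]
    exact Finset.dvd_sum fun i _ => (h i).mul_left _
  refine ⟨fun h => ?_, key _ y⟩
  have := key ((V⁻¹ : Matrix.GeneralLinearGroup (Fin n) ℤ) : Matrix (Fin n) (Fin n) ℤ) _ h
  rwa [Matrix.mulVec_mulVec, ← Units.val_mul, inv_mul_cancel, Units.val_one,
    Matrix.one_mulVec] at this

/-- Extend a vector indexed by the last coordinates by the first `m` coordinates of `y`. -/
def extendFirst (m : ℕ) {R : Type*} (y : Fin n → R) (z : {j : Fin n // m ≤ (j : ℕ)} → R) :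
    Fin n → R :=
  fun j => if h : m ≤ (j : ℕ) then z ⟨j, h⟩ else y j

theorem extendFirst_injective (m : ℕ) {R : Type*} (y : Fin n → R) :
    Function.Injective (extendFirst m y) := by
  intro z z' h
  ext ⟨j, hj⟩
  simpa [extendFirst, hj] using congrFun h j

/-- An invertible integer matrix preserves common divisors, and those of the joined vector are the
common divisors of its two blocks. -/
theorem isVisiblePoint_mulVec_extendFirst_iff (V : Matrix.GeneralLinearGroup (Fin n) ℤ) (m : ℕ)
    (y : Fin n → ℤ) (z : {j : Fin n // m ≤ (j : ℕ)} → ℤ) :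
    IsVisiblePoint ((V : Matrix (Fin n) (Fin n) ℤ).mulVec (extendFirst m y z)) ↔
      (gcdFirst m y).natAbs.gcd (Finset.univ.gcd z).natAbs = 1 := by
  set x := (V : Matrix (Fin n) (Fin n) ℤ).mulVec (extendFirst m y z)
  have h1 : (Finset.univ.gcd x).natAbs
      = (gcdFirst m y).natAbs.gcd (Finset.univ.gcd z).natAbs := by
    have key (d : ℕ) : d ∣ (Finset.univ.gcd x).natAbs ↔
        d ∣ (gcdFirst m y).natAbs.gcd (Finset.univ.gcd z).natAbs := by
      rw [natCast_dvd_natAbs_gcd_iff, forall_dvd_mulVec_iff, Nat.dvd_gcd_iff,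
        natCast_dvd_natAbs_gcd_iff, ← Int.natCast_dvd, gcdFirst, Finset.dvd_gcd_iff]
      simp only [Finset.mem_filter, Finset.mem_univ, true_and]
      constructor
      · refine fun h => ⟨fun j hj => ?_, fun ⟨j, hj⟩ => ?_⟩
        · simpa [extendFirst, hj.not_ge] using h j
        · simpa [extendFirst, hj] using h j
      · rintro ⟨ha, hb⟩ j
        by_cases hj : m ≤ (j : ℕ)
        · simpa [extendFirst, hj] using hb ⟨j, hj⟩
        · simpa [extendFirst, hj] using ha j (not_le.mp hj)
    exact Nat.dvd_antisymm ((key _).mp dvd_rfl) ((key _).mpr dvd_rfl)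
  rw [← h1, IsVisiblePoint, Int.natAbs_eq_iff]
  refine ⟨fun h => Or.inl (by simpa using h), ?_⟩
  rintro (h | h)
  · simpa using h
  · have h2 : 0 ≤ Finset.univ.gcd x := Int.nonneg_of_normalize_eq_self Finset.normalize_gcd
    omega

theorem card_subtype_fin_le (n m : ℕ) :
    Fintype.card {j : Fin n // m ≤ (j : ℕ)} = n - m := by
  rw [Fintype.card_subtype]
  rcases lt_or_ge m n with h | h
  · have : (Finset.univ.filter fun j : Fin n => m ≤ (j : ℕ)) = Finset.Ici ⟨m, h⟩ := by
      ext j; simp [Fin.le_def]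
    rw [this, Fin.card_Ici]
  · rw [Nat.sub_eq_zero_of_le h, Finset.card_eq_zero, Finset.filter_eq_empty_iff]
    intro j _
    have := j.2
    omega

end Unimodular

/-! ### Lattice points of the affine plane -/

section Parametrization

variable {s n : ℕ}

theorem mem_hyperplaneIntersection_intCast_iff (A : Matrix (Fin s) (Fin n) ℤ) (p x : Fin n → ℤ) :
    (fun j => (x j : ℝ)) ∈ hyperplaneIntersection A p ↔ A.mulVec x = A.mulVec p := by
  simp only [hyperplaneIntersection, Set.mem_iInter, Set.mem_ofPred_eq, funext_iff, Matrix.mulVec,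
    dotProduct]
  exact forall_congr' fun i => by norm_cast

/-- Cancelling the invertible `U` replaces `A V` by `D`, whose rank is that of `A`. -/
theorem mulVec_eq_mulVec_iff_forall_lt_rank {A D : Matrix (Fin s) (Fin n) ℤ}
    {U : Matrix.GeneralLinearGroup (Fin s) ℤ} {V : Matrix.GeneralLinearGroup (Fin n) ℤ}
    (hD : IsSmithNormalForm D)
    (hUAV : (U : Matrix (Fin s) (Fin s) ℤ) * A * (V : Matrix (Fin n) (Fin n) ℤ) = D)
    (y y' : Fin n → ℤ) :
    A.mulVec ((V : Matrix (Fin n) (Fin n) ℤ).mulVec y)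
        = A.mulVec ((V : Matrix (Fin n) (Fin n) ℤ).mulVec y') ↔
      ∀ j : Fin n, (j : ℕ) < A.rank → y j = y' j := by
  have hU : IsUnit (U : Matrix (Fin s) (Fin s) ℤ).det :=
    (Matrix.isUnit_iff_isUnit_det _).mp U.isUnit
  have hV : IsUnit (V : Matrix (Fin n) (Fin n) ℤ).det :=
    (Matrix.isUnit_iff_isUnit_det _).mp V.isUnit
  have hrank : D.rank = A.rank := by
    rw [← hUAV, Matrix.rank_mul_eq_left_of_isUnit_det _ _ hV,
      Matrix.rank_mul_eq_right_of_isUnit_det _ _ hU]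
  rw [← hrank, ← hD.mulVec_eq_mulVec_iff, ← hUAV]
  simp only [← Matrix.mulVec_mulVec]
  exact (Matrix.mulVec_injective_of_isUnit U.isUnit).eq_iff.symm

/-- The linear map sending the last coordinates `z` to `V (0, z)`. -/
def tailMap (V : Matrix (Fin n) (Fin n) ℤ) (m : ℕ) :
    ({j : Fin n // m ≤ (j : ℕ)} → ℝ) →ₗ[ℝ] (Fin n → ℝ) :=
  (V.map (Int.cast : ℤ → ℝ)).mulVecLin ∘ₗ
    { toFun := extendFirst m 0
      map_add' := fun x y => by ext j; by_cases h : m ≤ (j : ℕ) <;> simp [extendFirst, h]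
      map_smul' := fun a x => by ext j; by_cases h : m ≤ (j : ℕ) <;> simp [extendFirst, h] }

theorem tailMap_injective (V : Matrix.GeneralLinearGroup (Fin n) ℤ) (m : ℕ) :
    Function.Injective (tailMap (V : Matrix (Fin n) (Fin n) ℤ) m) := by
  have h : Function.Injective
      ((V : Matrix (Fin n) (Fin n) ℤ).map (Int.cast : ℤ → ℝ)).mulVec :=
    Matrix.mulVec_injective_of_isUnit (V.isUnit.map (Int.castRingHom ℝ).mapMatrix)
  exact fun z z' hz => extendFirst_injective m 0 (h hz)

theorem intCast_mulVec_extendFirst (V : Matrix (Fin n) (Fin n) ℤ) (m : ℕ) (y : Fin n → ℤ)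
    (z : {j : Fin n // m ≤ (j : ℕ)} → ℤ) :
    (fun j => (V.mulVec (extendFirst m y z) j : ℝ))
      = (fun j => (V.mulVec (extendFirst m y 0) j : ℝ))
        + (1 : ℝ) • tailMap V m (fun j => (z j : ℝ)) := by
  have h1 : V.mulVec (extendFirst m y z)
      = V.mulVec (extendFirst m y 0) + V.mulVec (extendFirst m 0 z) := by
    rw [← Matrix.mulVec_add]
    congr 1
    ext j
    by_cases h : m ≤ (j : ℕ) <;> simp [extendFirst, h]
  have h2 : tailMap V m (fun j => (z j : ℝ))
      = fun j => (V.mulVec (extendFirst m 0 z) j : ℝ) := by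
    ext i
    change ((V.map (Int.cast : ℤ → ℝ)).mulVec (extendFirst m 0 fun j => (z j : ℝ))) i = _
    simp only [Matrix.mulVec, dotProduct, Matrix.map_apply, Int.cast_sum, Int.cast_mul]
    refine Finset.sum_congr rfl fun j _ => ?_
    by_cases h : m ≤ (j : ℕ) <;> simp [extendFirst, h]
  rw [h1, h2]
  ext j
  simp

theorem mulVec_extendFirst_injective (V : Matrix.GeneralLinearGroup (Fin n) ℤ) (m : ℕ)
    (y : Fin n → ℤ) : Function.Injective fun z : {j : Fin n // m ≤ (j : ℕ)} → ℤ =>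
      (V : Matrix (Fin n) (Fin n) ℤ).mulVec (extendFirst m y z) :=
  (Matrix.mulVec_injective_of_isUnit V.isUnit).comp (extendFirst_injective m y)

/-- The lattice points of `Ax = Ap` in a cube, parametrized by the last coordinates of `V⁻¹ x`. -/
theorem latticePoints_hyperplaneIntersection_eq_image {A D : Matrix (Fin s) (Fin n) ℤ}
    {U : Matrix.GeneralLinearGroup (Fin s) ℤ} {V : Matrix.GeneralLinearGroup (Fin n) ℤ}
    (hD : IsSmithNormalForm D)
    (hUAV : (U : Matrix (Fin s) (Fin s) ℤ) * A * (V : Matrix (Fin n) (Fin n) ℤ) = D)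
    {p y : Fin n → ℤ} (hp : (V : Matrix (Fin n) (Fin n) ℤ).mulVec y = p) {r : ℝ} (hr : 0 ≤ r) :
    latticePoints (hyperplaneIntersection A p) r
      = (fun z => (V : Matrix (Fin n) (Fin n) ℤ).mulVec (extendFirst A.rank y z)) ''
        latticeBall (tailMap (V : Matrix (Fin n) (Fin n) ℤ) A.rank)
          (fun j => ((V : Matrix (Fin n) (Fin n) ℤ).mulVec (extendFirst A.rank y 0) j : ℝ))
          1 r := by
  have hball (z : {j : Fin n // A.rank ≤ (j : ℕ)} → ℤ) :
      z ∈ latticeBall (tailMap (V : Matrix (Fin n) (Fin n) ℤ) A.rank)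
          (fun j => ((V : Matrix (Fin n) (Fin n) ℤ).mulVec (extendFirst A.rank y 0) j : ℝ))
          1 r ↔
      ∀ j, ((V : Matrix (Fin n) (Fin n) ℤ).mulVec (extendFirst A.rank y z) j : ℝ)
        ∈ Set.Icc (-r) r := by
    change ‖_‖ ≤ r ↔ _
    -- The cube is the sup-norm ball of radius `r`, which needs `0 ≤ r`.
    rw [← intCast_mulVec_extendFirst, pi_norm_le_iff_of_nonneg hr]
    simp only [Real.norm_eq_abs, abs_le, Set.mem_Icc]
  ext x
  simp only [Set.mem_image, hball, latticePoints, Set.mem_ofPred_eq,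
    mem_hyperplaneIntersection_intCast_iff]
  constructor
  · rintro ⟨hx, hxr⟩
    obtain ⟨u, rfl⟩ : ∃ u, (V : Matrix (Fin n) (Fin n) ℤ).mulVec u = x :=
      ⟨((V⁻¹ : Matrix.GeneralLinearGroup (Fin n) ℤ) : Matrix (Fin n) (Fin n) ℤ).mulVec x, by
        rw [Matrix.mulVec_mulVec, ← Units.val_mul, mul_inv_cancel, Units.val_one,
          Matrix.one_mulVec]⟩
    rw [← hp, mulVec_eq_mulVec_iff_forall_lt_rank hD hUAV] at hx
    have hu : extendFirst A.rank y (fun j => u j) = u := by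
      ext j
      by_cases h : A.rank ≤ (j : ℕ)
      · simp [extendFirst, h]
      · simp [extendFirst, h, hx j (not_le.mp h)]
    exact ⟨fun j => u j, by rwa [hu], by rw [hu]⟩
  · rintro ⟨z, hz, rfl⟩
    refine ⟨?_, hz⟩
    rw [← hp, mulVec_eq_mulVec_iff_forall_lt_rank hD hUAV]
    intro j hj
    simp [extendFirst, hj.not_ge]

theorem visiblePoints_hyperplaneIntersection_eq_image {A D : Matrix (Fin s) (Fin n) ℤ}
    {U : Matrix.GeneralLinearGroup (Fin s) ℤ} {V : Matrix.GeneralLinearGroup (Fin n) ℤ}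
    (hD : IsSmithNormalForm D)
    (hUAV : (U : Matrix (Fin s) (Fin s) ℤ) * A * (V : Matrix (Fin n) (Fin n) ℤ) = D)
    {p y : Fin n → ℤ} (hp : (V : Matrix (Fin n) (Fin n) ℤ).mulVec y = p) {r : ℝ} (hr : 0 ≤ r) :
    visiblePoints (hyperplaneIntersection A p) r
      = (fun z => (V : Matrix (Fin n) (Fin n) ℤ).mulVec (extendFirst A.rank y z)) ''
        {z | z ∈ latticeBall (tailMap (V : Matrix (Fin n) (Fin n) ℤ) A.rank)
          (fun j => ((V : Matrix (Fin n) (Fin n) ℤ).mulVec (extendFirst A.rank y 0) j : ℝ))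
          1 r ∧ (gcdFirst A.rank y).natAbs.gcd (Finset.univ.gcd z).natAbs = 1} := by
  ext x
  simp only [visiblePoints, latticePoints_hyperplaneIntersection_eq_image hD hUAV hp hr,
    Set.mem_ofPred_eq, Set.mem_image]
  constructor
  · rintro ⟨⟨z, hz, rfl⟩, hv⟩
    exact ⟨z, ⟨hz, (isVisiblePoint_mulVec_extendFirst_iff V _ y z).mp hv⟩, rfl⟩
  · rintro ⟨z, ⟨hz, hv⟩, rfl⟩
    exact ⟨⟨z, hz, rfl⟩, (isVisiblePoint_mulVec_extendFirst_iff V _ y z).mpr hv⟩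

end Parametrization

/-! ### The density and the main theorem -/

section Density

variable {ι E : Type*} [Fintype ι] [NormedAddCommGroup E] [NormedSpace ℝ E]

theorem tendsto_div_of_tendsto_div_pow {f g : ℝ → ℝ} {k : ℕ} {a v : ℝ} (hv : v ≠ 0)
    (hf : Tendsto (fun t => f t / t ^ k) atTop (𝓝 (v * a)))
    (hg : Tendsto (fun t => g t / t ^ k) atTop (𝓝 v)) :
    Tendsto (fun t => f t / g t) atTop (𝓝 a) := by
  have h := hf.div hg hv
  rw [mul_div_cancel_left₀ _ hv] at h
  refine h.congr' ?_
  filter_upwards [eventually_gt_atTop 0] with t ht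
  exact div_div_div_cancel_right₀ (pow_pos ht k).ne' _ _

/-- Coprimality sees only the primes of `a`; the sieve needs a squarefree modulus for its divisor
sum to factor. -/
theorem radical_gcd_eq_one_iff {a b : ℕ} (ha : a ≠ 0) :
    (UniqueFactorizationMonoid.radical a).gcd b = 1 ↔ a.gcd b = 1 := by
  have hr : UniqueFactorizationMonoid.radical a ∣ a := UniqueFactorizationMonoid.radical_dvd_self
  refine ⟨fun h => ?_, fun h => Nat.Coprime.coprime_dvd_left hr h⟩
  exact Nat.Coprime.coprime_dvd_left (Nat.dvd_radical_pow_self ha) (Nat.Coprime.pow_left a h)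

/-- The density of the lattice points in a rank `k` lattice whose gcd is coprime to `b` is the
Euler product of `1 - q ^ (-k)` over the primes `q` dividing `b`. -/
theorem exists_hasProd_eulerFactor_and_tendsto (L : (ι → ℝ) →ₗ[ℝ] E)
    (hL : Function.Injective L) (c : E) (b : ℤ) (hc : b = 0 → c = 0) :
    ∃ ρ : ℝ, HasProd (eulerFactor b (Fintype.card ι)) ρ ∧
      Tendsto (fun t : ℝ => ({w | w ∈ latticeBall L c 1 t ∧
        b.natAbs.gcd (Finset.univ.gcd w).natAbs = 1}.ncard : ℝ)
          / ((latticeBall L c 1 t).ncard : ℝ)) atTop (𝓝 ρ) := by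
  obtain ⟨v, hv0, hv⟩ := exists_tendsto_ncard_latticeBall_zero_one L hL
  rcases eq_or_ne b 0 with rfl | hb
  · obtain rfl := hc rfl
    simp only [Int.natAbs_zero, Nat.gcd_zero_left, hasProd_eulerFactor_zero_iff]
    rcases le_or_gt (Fintype.card ι) 1 with hk | hk
    · exact ⟨0, hasProd_primes_one_sub_one_div_pow_of_le_one hk,
        tendsto_ncard_latticeBall_visible_div_of_card_le_one L hv0 hv hk⟩
    · exact ⟨_, hasProd_primes_one_sub_one_div_pow hk,
        tendsto_div_of_tendsto_div_pow hv0.ne' (tendsto_ncard_latticeBall_visible L hL hv hk) hv⟩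
  · have hb' : b.natAbs ≠ 0 := Int.natAbs_ne_zero.mpr hb
    refine ⟨_, hasProd_eulerFactor_of_ne_zero hb _, ?_⟩
    simp only [← radical_gcd_eq_one_iff hb']
    rw [← Nat.primeFactors_radical]
    have h1 := tendsto_ncard_latticeBall L hL hv c one_pos
    rw [one_pow, div_one] at h1
    exact tendsto_div_of_tendsto_div_pow hv0.ne' (tendsto_ncard_latticeBall_coprime L hL hv c
      UniqueFactorizationMonoid.squarefree_radical) h1

end Density

theorem theorem3p3 {s n : ℕ} (A D : Matrix (Fin s) (Fin n) ℤ)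
    (U : Matrix.GeneralLinearGroup (Fin s) ℤ) (V : Matrix.GeneralLinearGroup (Fin n) ℤ)
    (hD : IsSmithNormalForm D)
    (hUAV : (U : Matrix (Fin s) (Fin s) ℤ) * A * (V : Matrix (Fin n) (Fin n) ℤ) = D)
    (p p' : Fin n → ℤ)
    (hp' : p' = ((V⁻¹ : Matrix.GeneralLinearGroup (Fin n) ℤ) : Matrix (Fin n) (Fin n) ℤ).mulVec p)
    (m : ℕ) (hm : m = A.rank) (b : ℤ) (hb : b = gcdFirst m p') :
    Multipliable (eulerFactor b (n - m)) ∧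
    HasVisibleDensity (hyperplaneIntersection A p) (∏' q, eulerFactor b (n - m) q) ∧
    (b = 0 → 2 ≤ n - m →
      ((∏' q, eulerFactor b (n - m) q : ℝ) : ℂ) = 1 / riemannZeta ((n - m : ℕ) : ℂ)) ∧
    (b = 0 → n - m ≤ 1 → ∏' q, eulerFactor b (n - m) q = 0) := by
  have hp : (V : Matrix (Fin n) (Fin n) ℤ).mulVec p' = p := by
    rw [hp', Matrix.mulVec_mulVec, ← Units.val_mul, mul_inv_cancel, Units.val_one,
      Matrix.one_mulVec]
  have hc : b = 0 →
      (fun j => ((V : Matrix (Fin n) (Fin n) ℤ).mulVec (extendFirst m p' 0) j : ℝ)) = 0 := by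
    intro h0
    rw [hb, gcdFirst, Finset.gcd_eq_zero_iff] at h0
    -- A zero gcd makes the first `m` coordinates of `p'` vanish, so the base point is the origin.
    have : extendFirst m p' (0 : {j : Fin n // m ≤ (j : ℕ)} → ℤ) = 0 := by
      ext j
      by_cases h : m ≤ (j : ℕ)
      · simp [extendFirst, h]
      · simp [extendFirst, h, h0 j (by simpa using h)]
    ext j
    simp [this]
  obtain ⟨ρ, hρ, hlim⟩ := exists_hasProd_eulerFactor_and_tendsto
    (tailMap (V : Matrix (Fin n) (Fin n) ℤ) m) (tailMap_injective V m) _ b hc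
  rw [card_subtype_fin_le] at hρ
  refine ⟨hρ.multipliable, ?_, ?_, ?_⟩
  · rw [hρ.tprod_eq, HasVisibleDensity]
    refine hlim.congr' ?_
    filter_upwards [eventually_ge_atTop 0] with r hr
    rw [visiblePoints_hyperplaneIntersection_eq_image hD hUAV hp hr,
      latticePoints_hyperplaneIntersection_eq_image hD hUAV hp hr,
      Set.ncard_image_of_injective _ (mulVec_extendFirst_injective V A.rank p'),
      Set.ncard_image_of_injective _ (mulVec_extendFirst_injective V A.rank p'), hb, hm]
  · rintro rfl hk
    rw [(hasProd_eulerFactor_zero_iff.mpr (hasProd_primes_one_sub_one_div_pow hk)).tprod_eq]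
    exact ofReal_tsum_moebius_mul_one_div_pow hk
  · rintro rfl hk
    exact (hasProd_eulerFactor_zero_iff.mpr
      (hasProd_primes_one_sub_one_div_pow_of_le_one hk)).tprod_eq
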